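/- An \emph{interval exchange transformation} (IET) is a bijection $f:[0,1)\to[0,1)$ obtained by cutting $[0,1)$ into finitely many intervals $I_1,\dots,I_n$ of the form $[a,b)$, with lengths $\lambda_1,\dots,\lambda_n>0$, $\sum_i\lambda_i=1$, and rearranging them by translations in some other order. If $I_1,\dots,I_n$ are numbered from left to right, the permutation $\rho$ of $\{1,\dots,n\}$ describes the new order: after the exchange the intervals are, from left to right, $I_{\rho(1)},I_{\rho(2)},\dots,I_{\rho(n)}$. For a sequence $P=(x_i)_{i\ge1}$ in $[0,1)$ let $$D_N^*(P)=\sup_{0\le a\le 1}\left|\frac{\#\{1\le i\le N : x_i\in[0,a)\}}{N}-a\right|.$$ $P$ is a \emph{low-discrepancy sequence} if $D_N^*(P)=O(N^{-1}\log N)$ as $N\to\infty$. For integers $L,S\ge1$ let $\beta>0$ be the positive solution of $L\beta+S\beta^2=1$, and let $f_{L,S}$ be the IET with $n=L+S$ intervals of lengths $\lambda_i=\beta$ for $1\le i\le L$ and $\lambda_i=\beta^2$ for $L+1\le i\le L+S$, and with $$\rho_{L,S}(i)=i+1\ (1\le i\le L-1),\quad \rho_{L,S}(L)=L+S,\quad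 \rho_{L,S}(L+1)=1,\quad \rho_{L,S}(i)=i-1\ (L+2\le i\le L+S).$$ \textbf{Corollary.} Let $L\ge S\ge1$ be integers. For every interval exchange transformation $g$ and every $x\in[0,1)$, the orbit $\bigl((g f_{L,S}\,g^{-1})^i(x)\bigr)_{i\ge1}$ is a low-discrepancy sequence. -/

import Mathlib

open Filter Asymptotics MeasureTheory

noncomputable section

/-- The number of indices `1 ≤ i ≤ N` with `P i ∈ [0, a)`. -/
def countBelow (P : ℕ → Set.Ico (0 : ℝ) 1) (N : ℕ) (a : ℝ) : ℕ :=
  ((Finset.Icc 1 N).filter fun i => (P i : ℝ) < a).card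

/-- The star-discrepancy of the first `N` points `P 1, …, P N` of a sequence in `[0, 1)`: the
supremum over all intervals `[0, a) ⊆ [0, 1)`. -/
def starDiscrepancy (P : ℕ → Set.Ico (0 : ℝ) 1) (N : ℕ) : ℝ :=
  ⨆ a : Set.Icc (0 : ℝ) 1,
    |(countBelow P N a : ℝ) / N - volume.real (Set.Ico (0 : ℝ) a)|

/-- A low-discrepancy sequence: `D*_N(P) = O(N⁻¹ log N)`. -/
def IsLowDiscrepancy (P : ℕ → Set.Ico (0 : ℝ) 1) : Prop :=
  (fun N : ℕ => starDiscrepancy P N) =O[atTop] fun N : ℕ => (N : ℝ)⁻¹ * Real.log N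

/-- The orbit of `x`: the sequence `i ↦ f^i(x)`, to be read for `i ≥ 1`. -/
def orbitSeq (f : Set.Ico (0 : ℝ) 1 → Set.Ico (0 : ℝ) 1) (x : Set.Ico (0 : ℝ) 1) :
    ℕ → Set.Ico (0 : ℝ) 1 :=
  fun i => f^[i] x

/-- Data of an exchange of `n` intervals, labelled by `Fin n`. `len α` is the length of the
interval with label `α`; `π₀ k` and `π₁ k` are the labels of the `k`-th interval, counted from
the left, before and after the exchange. -/
structure IETData (n : ℕ) where
  π₀ : Equiv.Perm (Fin n)
  π₁ : Equiv.Perm (Fin n)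
  len : Fin n → ℝ
  len_pos : ∀ α, 0 < len α
  len_sum : ∑ α, len α = 1

namespace IETData

variable {n : ℕ}

/-- The left end point of the interval with label `α` when the intervals are lined up from left
to right in the order `π 0, π 1, …`. -/
def leftEnd (len : Fin n → ℝ) (π : Equiv.Perm (Fin n)) (α : Fin n) : ℝ :=
  ∑ γ with π.symm γ < π.symm α, len γ

/-- The interval with label `α` in that arrangement. -/
def piece (len : Fin n → ℝ) (π : Equiv.Perm (Fin n)) (α : Fin n) : Set ℝ :=
  Set.Ico (leftEnd len π α) (leftEnd len π α + len α)

theorem leftEnd_nonneg (D : IETData n) (π : Equiv.Perm (Fin n)) (α : Fin n) :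
    0 ≤ leftEnd D.len π α :=
  Finset.sum_nonneg fun γ _ => (D.len_pos γ).le

theorem leftEnd_add_le_sum (D : IETData n) (π : Equiv.Perm (Fin n)) (α : Fin n)
    (s : Finset (Fin n)) (hs : ∀ γ, π.symm γ ≤ π.symm α → γ ∈ s) :
    leftEnd D.len π α + D.len α ≤ ∑ γ ∈ s, D.len γ := by
  unfold leftEnd
  rw [add_comm, ← Finset.sum_insert (by simp)]
  refine Finset.sum_le_sum_of_subset_of_nonneg ?_ fun γ _ _ => (D.len_pos γ).le
  intro γ hγ
  apply hs
  rcases Finset.mem_insert.1 hγ with rfl | h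
  · exact le_rfl
  · exact (Finset.mem_filter.1 h).2.le

theorem sum_le_leftEnd_add (D : IETData n) (π : Equiv.Perm (Fin n)) (α : Fin n)
    (s : Finset (Fin n)) (hs : ∀ γ ∈ s, π.symm γ ≤ π.symm α) :
    ∑ γ ∈ s, D.len γ ≤ leftEnd D.len π α + D.len α := by
  unfold leftEnd
  rw [add_comm, ← Finset.sum_insert (by simp)]
  refine Finset.sum_le_sum_of_subset_of_nonneg ?_ fun γ _ _ => (D.len_pos γ).le
  intro γ hγ
  rcases (hs γ hγ).eq_or_lt with h | h
  · exact Finset.mem_insert.2 (Or.inl (π.symm.injective h))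
  · exact Finset.mem_insert_of_mem (Finset.mem_filter.2 ⟨Finset.mem_univ _, h⟩)

theorem leftEnd_add_le_one (D : IETData n) (π : Equiv.Perm (Fin n)) (α : Fin n) :
    leftEnd D.len π α + D.len α ≤ 1 := by
  rw [← D.len_sum]
  exact D.leftEnd_add_le_sum π α _ fun γ _ => Finset.mem_univ γ

/-- Different pieces of the same arrangement are disjoint. -/
theorem piece_unique (D : IETData n) (π : Equiv.Perm (Fin n)) {α β : Fin n} {x : ℝ}
    (hα : x ∈ piece D.len π α) (hβ : x ∈ piece D.len π β) : α = β := by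
  have key : ∀ {α β : Fin n}, x ∈ piece D.len π α → x ∈ piece D.len π β →
      ¬ π.symm α < π.symm β := by
    intro α β hα hβ h
    have h1 : leftEnd D.len π α + D.len α ≤ leftEnd D.len π β :=
      D.leftEnd_add_le_sum π α _ fun γ hγ =>
        Finset.mem_filter.2 ⟨Finset.mem_univ _, hγ.trans_lt h⟩
    exact absurd (hα.2.trans_le (h1.trans hβ.1)) (lt_irrefl x)
  exact π.symm.injective (le_antisymm (not_lt.1 (key hβ hα)) (not_lt.1 (key hα hβ)))

/-- The pieces cover `[0, 1)`. -/
theorem exists_piece (D : IETData n) (π : Equiv.Perm (Fin n)) (x : Set.Ico (0 : ℝ) 1) :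
    ∃ α, (x : ℝ) ∈ piece D.len π α := by
  have hne : (Finset.univ : Finset (Fin n)).Nonempty := by
    by_contra h
    have := D.len_sum
    rw [Finset.not_nonempty_iff_eq_empty.1 h] at this
    simp at this
  obtain ⟨ω, -, hω⟩ := Finset.exists_max_image Finset.univ (fun γ => π.symm γ) hne
  have h1 : (1 : ℝ) ≤ leftEnd D.len π ω + D.len ω := by
    rw [← D.len_sum]
    exact D.sum_le_leftEnd_add π ω _ fun γ hγ => hω γ hγ
  obtain ⟨α, hα, hmin⟩ := Finset.exists_min_image
    (Finset.univ.filter fun α => (x : ℝ) < leftEnd D.len π α + D.len α) (fun γ => π.symm γ)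
    ⟨ω, Finset.mem_filter.2 ⟨Finset.mem_univ _, x.2.2.trans_le h1⟩⟩
  refine ⟨α, ?_, (Finset.mem_filter.1 hα).2⟩
  rcases (Finset.univ.filter fun γ => π.symm γ < π.symm α).eq_empty_or_nonempty with h | h
  · unfold leftEnd
    rw [h, Finset.sum_empty]
    exact x.2.1
  · obtain ⟨β, hβ, hmax⟩ := Finset.exists_max_image _ (fun γ => π.symm γ) h
    have h2 : leftEnd D.len π α ≤ leftEnd D.len π β + D.len β :=
      D.sum_le_leftEnd_add π β _ hmax
    refine h2.trans (not_lt.1 fun hx => ?_)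
    exact absurd (hmin β (Finset.mem_filter.2 ⟨Finset.mem_univ _, hx⟩))
      (not_le.2 (Finset.mem_filter.1 hβ).2)

/-- The label of the piece containing `x`. -/
def label (D : IETData n) (π : Equiv.Perm (Fin n)) (x : Set.Ico (0 : ℝ) 1) : Fin n :=
  Classical.choose (D.exists_piece π x)

theorem label_spec (D : IETData n) (π : Equiv.Perm (Fin n)) (x : Set.Ico (0 : ℝ) 1) :
    (x : ℝ) ∈ piece D.len π (D.label π x) :=
  Classical.choose_spec (D.exists_piece π x)

theorem label_eq (D : IETData n) (π : Equiv.Perm (Fin n)) {x : Set.Ico (0 : ℝ) 1} {α : Fin n}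
    (h : (x : ℝ) ∈ piece D.len π α) : D.label π x = α :=
  D.piece_unique π (D.label_spec π x) h

theorem move_mem_piece (D : IETData n) (π π' : Equiv.Perm (Fin n)) (x : Set.Ico (0 : ℝ) 1) :
    x - leftEnd D.len π (D.label π x) + leftEnd D.len π' (D.label π x) ∈
      piece D.len π' (D.label π x) := by
  have h := D.label_spec π x
  constructor <;> linarith [h.1, h.2]

/-- Every piece of the arrangement `π` is translated onto the piece of the arrangement `π'` with
the same label. -/
def move (D : IETData n) (π π' : Equiv.Perm (Fin n)) (x : Set.Ico (0 : ℝ) 1) :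
    Set.Ico (0 : ℝ) 1 :=
  ⟨x - leftEnd D.len π (D.label π x) + leftEnd D.len π' (D.label π x),
    (D.leftEnd_nonneg π' _).trans (D.move_mem_piece π π' x).1,
    (D.move_mem_piece π π' x).2.trans_le (D.leftEnd_add_le_one π' _)⟩

theorem move_move (D : IETData n) (π π' : Equiv.Perm (Fin n)) (x : Set.Ico (0 : ℝ) 1) :
    D.move π' π (D.move π π' x) = x := by
  have h : D.label π' (D.move π π' x) = D.label π x :=
    D.label_eq π' (D.move_mem_piece π π' x)
  apply Subtype.ext
  change ((D.move π π' x : Set.Ico (0 : ℝ) 1) : ℝ) - leftEnd D.len π' (D.label π' (D.move π π' x))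
    + leftEnd D.len π (D.label π' (D.move π π' x)) = x
  rw [h]
  simp only [move]
  ring

/-- The interval exchange transformation with the given data, as a bijection of `[0, 1)`. -/
def toPerm (D : IETData n) : Equiv.Perm (Set.Ico (0 : ℝ) 1) where
  toFun := D.move D.π₀ D.π₁
  invFun := D.move D.π₁ D.π₀
  left_inv := D.move_move D.π₀ D.π₁
  right_inv := D.move_move D.π₁ D.π₀

end IETData

/-- `g` is an interval exchange transformation of `[0, 1)`, with some number of intervals. -/
def IsIET (g : Equiv.Perm (Set.Ico (0 : ℝ) 1)) : Prop :=
  ∃ (n : ℕ) (D : IETData n), g = D.toPerm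

/-- The positive solution of `L β + S β² = 1`, for `S ≥ 1`. -/
def betaLS (L S : ℕ) : ℝ := (-L + √((L : ℝ) ^ 2 + 4 * S)) / (2 * S)

theorem betaLS_pos (L S : ℕ) (hS : 1 ≤ S) : 0 < betaLS L S := by
  have hS' : (0 : ℝ) < S := by exact_mod_cast hS
  have h : (L : ℝ) < √((L : ℝ) ^ 2 + 4 * S) :=
    Real.lt_sqrt_of_sq_lt (by linarith)
  exact div_pos (by linarith) (by linarith)

theorem betaLS_eq (L S : ℕ) (hS : 1 ≤ S) :
    (L : ℝ) * betaLS L S + S * betaLS L S ^ 2 = 1 := by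
  have hS' : (0 : ℝ) < S := by exact_mod_cast hS
  have h : √((L : ℝ) ^ 2 + 4 * S) ^ 2 = (L : ℝ) ^ 2 + 4 * S := Real.sq_sqrt (by positivity)
  unfold betaLS
  field_simp
  linear_combination h

/-- The order `ρ(1), …, ρ(L+S)` of the labels `1, …, L+S` after the exchange. -/
def rhoLS (L S i : ℕ) : ℕ :=
  if i < L then i + 1
  else if i = L then L + S
  else if i = L + 1 then 1
  else i - 1

/-- The inverse of `rhoLS L S` on `{1, …, L+S}`. -/
def rhoLSInv (L S j : ℕ) : ℕ :=
  if j = 1 then L + 1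
  else if j ≤ L then j - 1
  else if j = L + S then L
  else j + 1

/-- `rhoLS L S` as a permutation of `Fin (L + S)`; the label `i` corresponds to the element
`i - 1` of `Fin (L + S)`. -/
def rhoPerm (L S : ℕ) (hL : 1 ≤ L) (hS : 1 ≤ S) : Equiv.Perm (Fin (L + S)) where
  toFun k := ⟨rhoLS L S (k + 1) - 1, by have := k.2; unfold rhoLS; split_ifs <;> omega⟩
  invFun k := ⟨rhoLSInv L S (k + 1) - 1, by have := k.2; unfold rhoLSInv; split_ifs <;> omega⟩
  left_inv k := by
    have := k.2
    apply Fin.ext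
    simp only [rhoLS, rhoLSInv]
    split_ifs <;> omega
  right_inv k := by
    have := k.2
    apply Fin.ext
    simp only [rhoLS, rhoLSInv]
    split_ifs <;> omega

/-- The lengths: `β` for the first `L` intervals, `β²` for the remaining `S` intervals. -/
def lenLS (L S : ℕ) (k : Fin (L + S)) : ℝ :=
  if (k : ℕ) < L then betaLS L S else betaLS L S ^ 2

theorem lenLS_sum (L S : ℕ) (hS : 1 ≤ S) : ∑ k, lenLS L S k = 1 := by
  rw [Fin.sum_univ_add]
  simp [lenLS, betaLS_eq L S hS]

/-- The data of `f_{L,S}`. -/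
def dataLS (L S : ℕ) (hL : 1 ≤ L) (hS : 1 ≤ S) : IETData (L + S) where
  π₀ := 1
  π₁ := rhoPerm L S hL hS
  len := lenLS L S
  len_pos k := by
    have := betaLS_pos L S hS
    unfold lenLS
    split_ifs <;> positivity
  len_sum := lenLS_sum L S hS

/-- The interval exchange transformation `f_{L,S}`. -/
def fLS (L S : ℕ) (hL : 1 ≤ L) (hS : 1 ≤ S) : Equiv.Perm (Set.Ico (0 : ℝ) 1) :=
  (dataLS L S hL hS).toPerm

end

/-! Everything reduces to a rotation by a badly approximable number. The columns of width `β` and `β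
^ 2` form towers over `[0, β)`: the map descends the long column by steps of `β`, climbs the short
one by steps of `β ^ 2`, and its first return to `[0, β)` is the rotation by `β ^ 2`, which after
scaling by `1 / β` is the rotation of the circle by `β` (`mapLS_tower`, `iterate_rotLS_div`).

For `S ≤ L` the number `β` is a quadratic irrational, hence badly approximable
(`exists_le_abs_betaLS_sub`). Splitting an orbit of the rotation into blocks of length a Dirichlet
denominator gives deviations `O(log N)`, uniformly in the starting point and in the interval `[0,
a)`. Summed over a tower, the deviation of `[0, c)` is a fixed-size combination of such deviations
with no constant term (`towerSum_cutDev`), so the bound passes to `fLS`.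

Conjugation by `g` costs only a constant factor: the preimage of `[0, a)` under `g` is a finite
union of intervals, so its deviation is a sum of differences of deviations of initial intervals
(`IETData.cutDev_toPerm`). -/

/-- The deviation at `y` of the indicator function of `(-∞, c)` from the value `c`. -/
noncomputable def cutDev (c y : ℝ) : ℝ := (if y < c then 1 else 0) - c

/-! ### Rotations: floor sums and logarithmic discrepancy -/

/-- Since `p` is invertible modulo `q`, the residues of `m + i * p` run through each class exactly
once. -/
theorem sum_emod_add_mul {p : ℤ} {q : ℕ} (hq : 0 < q) (hpq : IsCoprime (q : ℤ) p) (m : ℤ) :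
    ∑ i ∈ Finset.range q, (m + i * p) % (q : ℤ) = ∑ i ∈ Finset.range q, (i : ℤ) := by
  have hq' : (0 : ℤ) < q := by exact_mod_cast hq
  have hnn : ∀ i : ℕ, 0 ≤ (m + i * p) % (q : ℤ) := fun i => Int.emod_nonneg _ hq'.ne'
  have hlt : ∀ i : ℕ, (m + i * p) % (q : ℤ) < q := fun i => Int.emod_lt_of_pos _ hq'
  have hmaps : Set.MapsTo (fun i : ℕ => ((m + i * p) % (q : ℤ)).toNat)
      (Finset.range q) (Finset.range q) := by
    intro i _
    have := hnn i
    have := hlt i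
    simp only [Finset.coe_range, Set.mem_Iio]
    omega
  have hinj : Set.InjOn (fun i : ℕ => ((m + i * p) % (q : ℤ)).toNat) (Finset.range q) := by
    intro i hi j hj hij
    simp only [Finset.coe_range, Set.mem_Iio] at hi hj
    have h1 : (m + i * p) % (q : ℤ) = (m + j * p) % (q : ℤ) := by
      have := hnn i
      have := hnn j
      simp only at hij
      omega
    have h2 : (q : ℤ) ∣ ((i : ℤ) - j) * p := by
      have h3 := Int.dvd_of_emod_eq_zero (Int.emod_eq_emod_iff_emod_sub_eq_zero.1 h1)
      rwa [show m + (i : ℤ) * p - (m + j * p) = ((i : ℤ) - j) * p by ring] at h3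
    have h3 := hpq.dvd_of_dvd_mul_right h2
    have h4 := Int.eq_zero_of_abs_lt_dvd h3 (by rw [abs_lt]; omega)
    omega
  refine Finset.sum_nbij _ hmaps hinj
    (Finset.surjOn_of_injOn_of_card_le _ hmaps hinj le_rfl) fun i _ => ?_
  exact (Int.toNat_of_nonneg (hnn i)).symm

/-- In `q * (t / q) = t - t % q`, summed over `t = m + i * p`, the remainders contribute a total
independent of `m`. -/
theorem exists_sum_ediv_add_mul {p : ℤ} {q : ℕ} (hq : 0 < q) (hpq : IsCoprime (q : ℤ) p) :
    ∃ K : ℤ, ∀ m : ℤ, ∑ i ∈ Finset.range q, (m + i * p) / (q : ℤ) = m + K := by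
  have hq' : (0 : ℤ) < q := by exact_mod_cast hq
  have key : ∀ m : ℤ, q * ∑ i ∈ Finset.range q, (m + i * p) / (q : ℤ) =
      q * m + ∑ i ∈ Finset.range q, (i * p : ℤ) - ∑ i ∈ Finset.range q, (i : ℤ) := by
    intro m
    rw [← sum_emod_add_mul hq hpq m, Finset.mul_sum, eq_sub_iff_add_eq, ← Finset.sum_add_distrib]
    simp only [Int.mul_ediv_add_emod, Finset.sum_add_distrib, Finset.sum_const, Finset.card_range,
      nsmul_eq_mul]
  refine ⟨∑ i ∈ Finset.range q, (0 + i * p) / (q : ℤ), fun m => ?_⟩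
  apply mul_left_cancel₀ hq'.ne'
  rw [mul_add, key, key]
  ring

/-- Over `q` steps of a rotation close to `p / q`, the sum of the integer parts depends on the
starting point like `q * x`, up to a bounded error. -/
theorem exists_abs_sum_floor_sub_le {α : ℝ} {r : ℚ} (hr : |α - r| * (r.den : ℝ) ^ 2 ≤ 1) :
    ∃ K : ℤ, ∀ x : ℝ,
      |∑ i ∈ Finset.range r.den, (⌊x + i * α⌋ : ℝ) - (r.den * x + K)| ≤ 2 := by
  obtain ⟨K, hK⟩ := exists_sum_ediv_add_mul r.den_pos
    (Int.isCoprime_iff_gcd_eq_one.2 (by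
      rw [Int.gcd_comm]; exact r.reduced : Int.gcd (r.den : ℤ) r.num = 1))
  refine ⟨K, fun x => ?_⟩
  have hq : (0 : ℝ) < r.den := by exact_mod_cast r.den_pos
  have hq' : (0 : ℤ) < r.den := by exact_mod_cast r.den_pos
  have hnum : (r : ℝ) * r.den = r.num := by exact_mod_cast Rat.mul_den_eq_num r
  -- In units of `1 / q`, replacing `α` by `p / q` displaces each of the first `q` orbit points by
  -- at most `q ^ 2 * |α - r| ≤ 1`.
  have herr : ∀ i ∈ Finset.range r.den, |(i : ℝ) * α * r.den - i * r.num| ≤ 1 := by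
    intro i hi
    have hi' : (i : ℝ) ≤ r.den := by exact_mod_cast (Finset.mem_range.1 hi).le
    rw [← hnum, show (i : ℝ) * α * r.den - i * (r * r.den) = i * r.den * (α - r) by ring, abs_mul,
      abs_of_nonneg (by positivity)]
    refine le_trans ?_ hr
    rw [mul_comm, sq]
    gcongr
  have hup : ∑ i ∈ Finset.range r.den, ⌊x + i * α⌋ ≤ ⌊r.den * x⌋ + 1 + K := by
    rw [← hK]
    refine Finset.sum_le_sum fun i hi => ?_
    rw [Int.le_ediv_iff_mul_le hq']
    have h1 := abs_le.1 (herr i hi)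
    have h2 : (⌊x + i * α⌋ : ℝ) * r.den ≤ (x + i * α) * r.den :=
      mul_le_mul_of_nonneg_right (Int.floor_le _) hq.le
    have h3 : ⌊x + i * α⌋ * r.den - 1 - i * r.num ≤ ⌊r.den * x⌋ := by
      rw [Int.le_floor]
      push_cast
      linarith [h1.2]
    linarith
  have hlo : ⌊r.den * x⌋ - 1 + K ≤ ∑ i ∈ Finset.range r.den, ⌊x + i * α⌋ := by
    rw [← hK]
    refine Finset.sum_le_sum fun i hi => ?_
    rw [Int.le_floor]
    have h1 := abs_le.1 (herr i hi)
    have h2 : (((⌊r.den * x⌋ - 1 + i * r.num) / (r.den : ℤ) : ℤ) : ℝ) * r.den ≤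
        ⌊r.den * x⌋ - 1 + i * r.num := by
      exact_mod_cast Int.ediv_mul_le _ hq'.ne'
    refine le_of_mul_le_mul_right ?_ hq
    linarith [h1.1, Int.floor_le (r.den * x)]
  have hup' : (∑ i ∈ Finset.range r.den, (⌊x + i * α⌋ : ℝ)) ≤ ⌊r.den * x⌋ + 1 + K := by
    exact_mod_cast hup
  have hlo' : ⌊r.den * x⌋ - 1 + K ≤ (∑ i ∈ Finset.range r.den, (⌊x + i * α⌋ : ℝ)) := by
    exact_mod_cast hlo
  rw [abs_le]
  constructor <;> linarith [Int.floor_le (r.den * x), Int.lt_floor_add_one (r.den * x)]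

/-- Writing the indicator as a difference of floors makes the floor-sum estimate applicable. -/
theorem cutDev_fract {a : ℝ} (ha : a ∈ Set.Icc (0 : ℝ) 1) (y : ℝ) :
    cutDev a (Int.fract y) = ⌊y⌋ - ⌊y - a⌋ - a := by
  unfold cutDev
  have h0 := Int.fract_nonneg y
  have h1 := Int.fract_lt_one y
  have h2 := Int.self_sub_floor y
  split_ifs with h
  · have : ⌊y - a⌋ = ⌊y⌋ - 1 := by
      rw [Int.floor_eq_iff]
      push_cast
      constructor <;> linarith [ha.2]
    rw [this]
    push_cast
    ring
  · have : ⌊y - a⌋ = ⌊y⌋ := by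
      rw [Int.floor_eq_iff]
      constructor <;> linarith [ha.1]
    rw [this]
    ring

/-- The floor sums started at `x` and at `x - a` share the same `K`, and their main terms differ by
exactly `q * a`; two errors of size `2` remain. -/
theorem abs_sum_cutDev_fract_le {α : ℝ} {r : ℚ} (hr : |α - r| * (r.den : ℝ) ^ 2 ≤ 1)
    {a : ℝ} (ha : a ∈ Set.Icc (0 : ℝ) 1) (x : ℝ) :
    |∑ i ∈ Finset.range r.den, cutDev a (Int.fract (x + i * α))| ≤ 4 := by
  obtain ⟨K, hK⟩ := exists_abs_sum_floor_sub_le hr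
  have h1 := abs_le.1 (hK x)
  have h2 := abs_le.1 (hK (x - a))
  have h3 : ∑ i ∈ Finset.range r.den, cutDev a (Int.fract (x + i * α)) =
      ∑ i ∈ Finset.range r.den, (⌊x + i * α⌋ : ℝ) -
        ∑ i ∈ Finset.range r.den, (⌊x - a + i * α⌋ : ℝ) - r.den * a := by
    simp only [cutDev_fract ha, Finset.sum_sub_distrib, Finset.sum_const, Finset.card_range,
      nsmul_eq_mul, add_sub_right_comm]
  rw [h3, abs_le]
  constructor <;> linarith

/-- Orbits of the rotation by a badly approximable number have logarithmic discrepancy. -/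
theorem exists_abs_sum_cutDev_fract_le_log {α c : ℝ} (hc : 0 < c)
    (hα : ∀ r : ℚ, c ≤ |α - r| * (r.den : ℝ) ^ 2) :
    ∃ C : ℝ, 0 ≤ C ∧ ∀ a ∈ Set.Icc (0 : ℝ) 1, ∀ (N : ℕ) (x : ℝ),
      |∑ i ∈ Finset.range N, cutDev a (Int.fract (x + i * α))| ≤ C * Real.log (N + 1) := by
  -- Each removed block costs at most `4` and lowers `log (N + 1)` by at least `c`.
  refine ⟨4 / c, by positivity, fun a ha N => ?_⟩
  induction N using Nat.strong_induction_on with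
  | _ N ih =>
    intro x
    rcases Nat.eq_zero_or_pos N with rfl | hN
    · simp
    obtain ⟨r, hr, hrN⟩ := Real.exists_rat_abs_sub_le_and_den_le α hN
    have hq : (0 : ℝ) < r.den := by exact_mod_cast r.den_pos
    have hqN : (r.den : ℝ) ≤ N := by exact_mod_cast hrN
    have hr' : |α - r| * ((N + 1) * r.den) ≤ 1 := by
      rwa [le_div_iff₀ (by positivity)] at hr
    have hr1 : |α - r| * (r.den : ℝ) ^ 2 ≤ 1 := by
      refine le_trans ?_ hr'
      rw [sq]
      gcongr
      linarith
    -- Bad approximability forces the Dirichlet denominator to be a fixed proportion of `N + 1`.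
    have hden : c * (N + 1) ≤ r.den := by
      have h1 := mul_le_mul_of_nonneg_right (hα r) (by positivity : (0 : ℝ) ≤ N + 1)
      have h2 := mul_le_mul_of_nonneg_right hr' hq.le
      linarith
    obtain ⟨M, rfl⟩ := Nat.exists_eq_add_of_le hrN
    rw [Finset.sum_range_add]
    have h1 := abs_sum_cutDev_fract_le hr1 ha x
    have h2 := ih M (by have := r.den_pos; omega) (x + r.den * α)
    have h3 : ∑ i ∈ Finset.range M, cutDev a (Int.fract (x + ((r.den + i : ℕ) : ℝ) * α)) =
        ∑ i ∈ Finset.range M, cutDev a (Int.fract (x + r.den * α + i * α)) := by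
      refine Finset.sum_congr rfl fun i _ => ?_
      push_cast
      ring_nf
    rw [h3]
    refine (abs_add_le _ _).trans ((add_le_add h1 h2).trans ?_)
    push_cast at hden ⊢
    set T : ℝ := (r.den : ℝ) + M + 1 with hT
    have hT0 : 0 < T := by positivity
    -- With `q = r.den`, `log (1 - q / T) ≤ -q / T ≤ -c`.
    have h4 : Real.log (M + 1) ≤ Real.log T - c := by
      have h5 : Real.log ((M + 1) / T) ≤ (M + 1) / T - 1 :=
        Real.log_le_sub_one_of_pos (by positivity)
      have h6 : (M + 1) / T - 1 ≤ -c := by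
        rw [div_sub_one hT0.ne', div_le_iff₀ hT0]
        linarith
      rw [Real.log_div (by positivity) hT0.ne'] at h5
      linarith
    have h5 : 4 / c * Real.log (M + 1) ≤ 4 / c * (Real.log T - c) :=
      mul_le_mul_of_nonneg_left h4 (by positivity)
    have h6 : 4 / c * c = 4 := by field_simp
    linarith

/-! ### Bad approximability of `β` -/

/-- A rational root would make `L ^ 2 + 4 * S` a perfect square. As `1 ≤ S ≤ L`, it lies strictly
between `L ^ 2` and `(L + 2) ^ 2`, and it differs from `(L + 1) ^ 2` by parity. -/
theorem quadratic_rat_ne_zero {L S : ℕ} (hS : 1 ≤ S) (hLS : S ≤ L) (r : ℚ) :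
    (S : ℚ) * r ^ 2 + L * r - 1 ≠ 0 := by
  intro h
  have h1 : IsSquare ((L * L + 4 * S : ℕ) : ℚ) :=
    ⟨2 * S * r + L, by push_cast; linear_combination (-4 * S : ℚ) * h⟩
  rw [Rat.isSquare_natCast_iff] at h1
  obtain ⟨m, hm⟩ := h1
  have h2 : L < m := by nlinarith
  have h3 : m < L + 2 := by nlinarith
  obtain rfl : m = L + 1 := by omega
  have : (L + 1) * (L + 1) = L * L + 2 * L + 1 := by ring
  omega

/-- `betaLS L S` is badly approximable when `S ≤ L`. -/
theorem exists_le_abs_betaLS_sub {L S : ℕ} (hS : 1 ≤ S) (hLS : S ≤ L) :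
    ∃ c : ℝ, 0 < c ∧ ∀ r : ℚ, c ≤ |betaLS L S - r| * (r.den : ℝ) ^ 2 := by
  have hβ := betaLS_pos L S hS
  have heq := betaLS_eq L S hS
  set β := betaLS L S
  have hS' : (1 : ℝ) ≤ S := by exact_mod_cast hS
  -- Bounds the cofactor `S * (r + β) + L` of `r - β` in `S * r ^ 2 + L * r - 1` when `|β - r| < 1`.
  set M : ℝ := S + 2 * S * β + L with hM
  have hM1 : 1 ≤ M := by
    have : 0 ≤ 2 * S * β := by positivity
    have : (0 : ℝ) ≤ L := by positivity
    linarith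
  refine ⟨1 / M, by positivity, fun r => ?_⟩
  have hq : (1 : ℝ) ≤ r.den := by exact_mod_cast r.den_pos
  have hq2 : (1 : ℝ) ≤ (r.den : ℝ) ^ 2 := one_le_pow₀ hq
  rcases le_or_gt 1 |β - r| with h | h
  · calc 1 / M ≤ 1 := by rw [div_le_one (by linarith)]; exact hM1
      _ ≤ |β - r| * (r.den : ℝ) ^ 2 := one_le_mul_of_one_le_of_one_le h hq2
  have hnum : (r : ℝ) * r.den = r.num := by exact_mod_cast Rat.mul_den_eq_num r
  -- Liouville's argument: a nonzero integer has absolute value at least `1`.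
  have hint : (1 : ℝ) ≤ |(S : ℝ) * r.num ^ 2 + L * r.num * r.den - r.den ^ 2| := by
    have h1 : (S : ℤ) * r.num ^ 2 + L * r.num * r.den - r.den ^ 2 ≠ 0 := by
      intro h0
      have h0' : (S : ℚ) * r.num ^ 2 + L * r.num * r.den - r.den ^ 2 = 0 := by exact_mod_cast h0
      rw [← Rat.mul_den_eq_num r] at h0'
      apply quadratic_rat_ne_zero hS hLS r
      have hd : (r.den : ℚ) ≠ 0 := by exact_mod_cast r.den_pos.ne'
      have : (r.den : ℚ) ^ 2 ≠ 0 := pow_ne_zero 2 hd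
      apply mul_right_cancel₀ this
      linear_combination h0'
    exact_mod_cast Int.one_le_abs h1
  have hfac : (S : ℝ) * r.num ^ 2 + L * r.num * r.den - r.den ^ 2 =
      (r - β) * (r.den : ℝ) ^ 2 * (S * (r - β) + 2 * S * β + L) := by
    rw [← hnum]
    linear_combination (r.den : ℝ) ^ 2 * heq
  rw [hfac, abs_mul, abs_mul, abs_sub_comm, abs_of_nonneg (by positivity : 0 ≤ (r.den : ℝ) ^ 2)]
    at hint
  have hbd : |(S : ℝ) * (r - β) + 2 * S * β + L| ≤ M := by
    have h1 := abs_lt.1 h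
    have : 0 ≤ 2 * S * β := by positivity
    have : (0 : ℝ) ≤ L := by positivity
    rw [abs_le]
    constructor <;> nlinarith
  rw [div_le_iff₀ (by linarith)]
  exact hint.trans (mul_le_mul_of_nonneg_left hbd (by positivity))

/-! ### Interval exchanges and deviations of initial intervals -/

/-- The truncation of `x` to the interval `[0, b]`. -/
noncomputable def clip (b x : ℝ) : ℝ := max 0 (min b x)

theorem clip_mem {b : ℝ} (hb : 0 ≤ b) (x : ℝ) : clip b x ∈ Set.Icc 0 b :=
  ⟨le_max_left _ _, max_le hb (min_le_left _ _)⟩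

theorem lt_clip_iff {b x y : ℝ} (h0 : 0 ≤ y) (h1 : y < b) : y < clip b x ↔ y < x := by
  simp [clip, h0.not_gt, h1]

/-- This is the length of `[p, p + b) ∩ [0, a)` when `0 ≤ p` and `0 ≤ a`; written as a difference,
it telescopes over adjacent intervals. -/
theorem clip_sub {b : ℝ} (hb : 0 ≤ b) (a p : ℝ) : clip b (a - p) = min a (p + b) - min a p := by
  unfold clip
  rcases le_total a (p + b) with h1 | h1 <;> rcases le_total a p with h2 | h2
  · rw [min_eq_right (by linarith), max_eq_left (by linarith), min_eq_left h1, min_eq_left h2]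
    ring
  · rw [min_eq_right (by linarith), max_eq_right (by linarith), min_eq_left h1, min_eq_right h2]
  · rw [min_eq_left (by linarith), max_eq_right (by linarith), min_eq_right h1, min_eq_left h2]
    linarith
  · rw [min_eq_left (by linarith), max_eq_right hb, min_eq_right h1, min_eq_right h2]
    ring

/-- Consecutive intervals `[p k, p (k + 1))` cut `[0, a)` into pieces of total length `a`. -/
theorem sum_range_clip {P b : ℕ → ℝ} {n : ℕ} (hb : ∀ k < n, 0 ≤ b k)
    (hP : ∀ k < n, P (k + 1) = P k + b k) (a : ℝ) :
    ∑ k ∈ Finset.range n, clip (b k) (a - P k) = min a (P n) - min a (P 0) := by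
  rw [← Finset.sum_range_sub (fun k => min a (P k)) n]
  refine Finset.sum_congr rfl fun k hk => ?_
  have hk' := Finset.mem_range.1 hk
  rw [clip_sub (hb k hk'), hP k hk']

namespace IETData

variable {n : ℕ}

/-- Reduces computing left ends to guessing a closed form for the partial sums of the lengths and
checking its increments. -/
theorem leftEnd_eq_of_partialSums (len : Fin n → ℝ) (π : Equiv.Perm (Fin n)) {P : ℕ → ℝ}
    (h0 : P 0 = 0) (hP : ∀ k : Fin n, P (k + 1) = P k + len (π k)) (α : Fin n) :
    leftEnd len π α = P (π.symm α) := by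
  have key : ∀ k ≤ n, ∑ γ with ((π.symm γ : Fin n) : ℕ) < k, len γ = P k := by
    intro k
    induction k with
    | zero => intro _; simp [h0]
    | succ k ih =>
      intro hk
      rw [hP ⟨k, hk⟩, ← ih (by omega), add_comm (∑ γ with _, len γ),
        ← Finset.sum_insert (by simp)]
      refine Finset.sum_congr ?_ fun _ _ => rfl
      ext γ
      simp only [Finset.mem_filter, Finset.mem_univ, true_and, Finset.mem_insert]
      rw [← Equiv.symm_apply_eq, Fin.ext_iff, Order.lt_add_one_iff, le_iff_eq_or_lt]
  exact key _ (π.symm α).2.le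

theorem toPerm_apply_of_mem_piece (D : IETData n) {x : Set.Ico (0 : ℝ) 1} {α : Fin n}
    (h : (x : ℝ) ∈ piece D.len D.π₀ α) :
    (D.toPerm x : ℝ) = x - leftEnd D.len D.π₀ α + leftEnd D.len D.π₁ α := by
  rw [← D.label_eq D.π₀ h]
  rfl

/-- The pieces tile `[0, 1)`, so their overlaps with `[0, a)` have total length `a`. This makes the
centring constants match in `cutDev_toPerm`. -/
theorem sum_clip_leftEnd (D : IETData n) (π : Equiv.Perm (Fin n)) {a : ℝ}
    (ha : a ∈ Set.Icc (0 : ℝ) 1) :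
    ∑ α, clip (D.len α) (a - leftEnd D.len π α) = a := by
  set b : ℕ → ℝ := fun k => if h : k < n then D.len (π ⟨k, h⟩) else 0 with hb
  set P : ℕ → ℝ := fun k => ∑ j ∈ Finset.range k, b j with hP
  have hbk : ∀ k : Fin n, b k = D.len (π k) := fun k => by simp [hb]
  have hPk : ∀ k : Fin n, P (k + 1) = P k + D.len (π k) := fun k => by
    rw [← hbk]
    exact Finset.sum_range_succ _ _
  have hPn : P n = 1 := by
    rw [← D.len_sum, ← Equiv.sum_comp π, hP]
    simp only [← hbk]
    exact Finset.sum_range b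
  have h1 := sum_range_clip (P := P) (b := b) (n := n)
    (fun k hk => by rw [hbk ⟨k, hk⟩]; exact (D.len_pos _).le)
    (fun k _ => Finset.sum_range_succ _ _) a
  rw [hPn, show P 0 = 0 from Finset.sum_range_zero _, min_eq_left ha.2, min_eq_right ha.1,
    sub_zero, Finset.sum_range] at h1
  rw [← Equiv.sum_comp π]
  refine (Finset.sum_congr rfl fun k _ => ?_).trans h1
  rw [leftEnd_eq_of_partialSums D.len π (Finset.sum_range_zero b) hPk, hbk,
    Equiv.symm_apply_apply]

/-- The deviation of the visits to `[0, a)` after an interval exchange is a sum of deviations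
before it. -/
theorem cutDev_toPerm (D : IETData n) {a : ℝ} (ha : a ∈ Set.Icc (0 : ℝ) 1)
    (y : Set.Ico (0 : ℝ) 1) :
    cutDev a (D.toPerm y) =
      ∑ α, (cutDev (leftEnd D.len D.π₀ α + clip (D.len α) (a - leftEnd D.len D.π₁ α)) y -
        cutDev (leftEnd D.len D.π₀ α) y) := by
  have hy := D.label_spec D.π₀ y
  set ω := D.label D.π₀ y with hω
  -- The part of piece `α` sent into `[0, a)` is an initial segment of it; only the piece containing
  -- `y` can contribute an indicator, the others just the centring constant.
  have hrest : ∀ α, cutDev (leftEnd D.len D.π₀ α + clip (D.len α) (a - leftEnd D.len D.π₁ α)) y -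
      cutDev (leftEnd D.len D.π₀ α) y = (if α = ω then (if (D.toPerm y : ℝ) < a then 1 else 0)
        else 0) - clip (D.len α) (a - leftEnd D.len D.π₁ α) := by
    intro α
    have hc := clip_mem (D.len_pos α).le (a - leftEnd D.len D.π₁ α)
    unfold cutDev
    by_cases h : α = ω
    · subst h
      rw [if_neg (not_lt.2 hy.1), if_pos rfl, D.toPerm_apply_of_mem_piece hy]
      have h1 := lt_clip_iff (x := a - leftEnd D.len D.π₁ ω) (sub_nonneg.2 hy.1)
        (sub_left_lt_of_lt_add hy.2)
      have h2 : (y : ℝ) < leftEnd D.len D.π₀ ω + clip (D.len ω) (a - leftEnd D.len D.π₁ ω) ↔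
          (y : ℝ) - leftEnd D.len D.π₀ ω + leftEnd D.len D.π₁ ω < a := by
        rw [← sub_lt_iff_lt_add', h1, lt_sub_iff_add_lt]
      simp only [h2]
      ring
    · rw [if_neg h]
      have h1 : ¬ (y : ℝ) ∈ piece D.len D.π₀ α := fun h1 => h (D.piece_unique D.π₀ h1 hy)
      rcases lt_or_ge (y : ℝ) (leftEnd D.len D.π₀ α) with h2 | h2
      · rw [if_pos h2, if_pos (by linarith [hc.1])]
        ring
      · have h3 : leftEnd D.len D.π₀ α + D.len α ≤ y := not_lt.1 fun h3 => h1 ⟨h2, h3⟩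
        rw [if_neg h2.not_gt, if_neg (by linarith [hc.2])]
        ring
  rw [Finset.sum_congr rfl fun α _ => hrest α, Finset.sum_sub_distrib, D.sum_clip_leftEnd D.π₁ ha]
  simp [cutDev]

end IETData

/-! ### Explicit form of `fLS` -/

/-- The map `fLS` as a piecewise translation of the real line. -/
noncomputable def mapLS (L : ℕ) (β y : ℝ) : ℝ :=
  if y < β then y + (L - 1) * β + β ^ 2
  else if y < L * β then y - β
  else if y < 1 - β ^ 2 then y + β ^ 2
  else y - 1 + β ^ 2 + (L - 1) * β

theorem leftEnd_lenLS_one (L S : ℕ) (k : Fin (L + S)) :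
    IETData.leftEnd (lenLS L S) 1 k =
      if (k : ℕ) ≤ L then (k : ℝ) * betaLS L S
      else L * betaLS L S + (k - L) * betaLS L S ^ 2 := by
  refine IETData.leftEnd_eq_of_partialSums (lenLS L S) 1 (P := fun k => if k ≤ L then
    (k : ℝ) * betaLS L S else L * betaLS L S + (k - L) * betaLS L S ^ 2) (by simp) ?_ k
  intro k
  rw [Equiv.Perm.one_apply, lenLS]
  rcases lt_trichotomy (k : ℕ) L with h | h | h
  · rw [if_pos (by omega), if_pos (by omega), if_pos h]
    push_cast
    ring
  · rw [if_neg (by omega), if_pos (by omega), if_neg (by omega), h]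
    push_cast
    ring
  · rw [if_neg (by omega), if_neg (by omega), if_neg (by omega)]
    push_cast
    ring

theorem leftEnd_lenLS_rho (L S : ℕ) (hL : 1 ≤ L) (hS : 1 ≤ S) (k : Fin (L + S)) :
    IETData.leftEnd (lenLS L S) (rhoPerm L S hL hS) k =
      if (k : ℕ) = 0 then (L - 1) * betaLS L S + betaLS L S ^ 2
      else if (k : ℕ) < L then (k - 1) * betaLS L S
      else if (k : ℕ) + 1 = L + S then (L - 1) * betaLS L S
      else L * betaLS L S + (k + 1 - L) * betaLS L S ^ 2 := by
  set β := betaLS L S with hβ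
  -- After the exchange the lengths read: `L - 1` times `β`, once `β ^ 2`, once `β`, then `S - 1`
  -- times `β ^ 2`.
  rw [IETData.leftEnd_eq_of_partialSums (lenLS L S) (rhoPerm L S hL hS) (P := fun k =>
    if k < L then (k : ℝ) * β else if k = L then (L - 1) * β + β ^ 2
      else L * β + (k - L) * β ^ 2) (by simp; omega) ?_ k]
  · have hk : (((rhoPerm L S hL hS).symm k : Fin (L + S)) : ℕ) = rhoLSInv L S (k + 1) - 1 := rfl
    have hk2 := k.2
    simp only [hk]
    by_cases h0 : (k : ℕ) = 0
    · rw [if_pos h0, show rhoLSInv L S (k + 1) - 1 = L by unfold rhoLSInv; split_ifs <;> omega]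
      simp
    rw [if_neg h0]
    by_cases h1 : (k : ℕ) < L
    · rw [if_pos h1, show rhoLSInv L S (k + 1) - 1 = k - 1 by
        unfold rhoLSInv; split_ifs <;> omega, if_pos (by omega), Nat.cast_sub (by omega)]
      simp
    rw [if_neg h1]
    by_cases h2 : (k : ℕ) + 1 = L + S
    · rw [if_pos h2, show rhoLSInv L S (k + 1) - 1 = L - 1 by
        unfold rhoLSInv; split_ifs <;> omega, if_pos (by omega), Nat.cast_sub (by omega)]
      simp
    rw [if_neg h2, show rhoLSInv L S (k + 1) - 1 = k + 1 by
        unfold rhoLSInv; split_ifs <;> omega, if_neg (by omega), if_neg (by omega)]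
    push_cast
    ring
  · intro k
    have hk : ((rhoPerm L S hL hS k : Fin (L + S)) : ℕ) = rhoLS L S (k + 1) - 1 := rfl
    have hk2 := k.2
    simp only [lenLS, hk, ← hβ]
    rcases lt_trichotomy (k : ℕ) L with h | h | h
    · by_cases h1 : (k : ℕ) + 1 = L
      · have h2 : (k : ℝ) + 1 = L := by exact_mod_cast h1
        rw [show rhoLS L S (k + 1) - 1 = L + S - 1 by unfold rhoLS; split_ifs <;> omega,
          if_neg (by omega), if_pos (by omega), if_pos (by omega), if_neg (by omega), ← h2]
        ring
      · rw [show rhoLS L S (k + 1) - 1 = k + 1 by unfold rhoLS; split_ifs <;> omega,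
          if_pos (by omega), if_pos (by omega), if_pos (by omega)]
        push_cast
        ring
    · rw [show rhoLS L S (k + 1) - 1 = 0 by unfold rhoLS; split_ifs <;> omega,
          if_neg (by omega), if_neg (by omega), if_neg (by omega), if_pos (by omega),
          if_pos (by omega), h]
      push_cast
      ring
    · rw [show rhoLS L S (k + 1) - 1 = k - 1 by unfold rhoLS; split_ifs <;> omega,
          if_neg (by omega), if_neg (by omega), if_neg (by omega), if_neg (by omega),
          if_neg (by omega)]
      push_cast
      ring

/-- Labels `2, …, L` share one translation and labels `L + 1, …, L + S - 1` share another, so with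
the first and the last label four branches suffice. -/
theorem coe_fLS (L S : ℕ) (hL : 1 ≤ L) (hS : 1 ≤ S) (y : Set.Ico (0 : ℝ) 1) :
    (fLS L S hL hS y : ℝ) = mapLS L (betaLS L S) y := by
  have hy := (dataLS L S hL hS).label_spec 1 y
  set k := (dataLS L S hL hS).label 1 y
  have h1 := (dataLS L S hL hS).toPerm_apply_of_mem_piece hy
  have heq := betaLS_eq L S hS
  have hpos := betaLS_pos L S hS
  change (fLS L S hL hS y : ℝ) = y - IETData.leftEnd (lenLS L S) 1 k +
    IETData.leftEnd (lenLS L S) (rhoPerm L S hL hS) k at h1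
  change (y : ℝ) ∈ Set.Ico (IETData.leftEnd (lenLS L S) 1 k)
    (IETData.leftEnd (lenLS L S) 1 k + lenLS L S k) at hy
  rw [h1]
  rw [leftEnd_lenLS_one, lenLS] at hy
  rw [leftEnd_lenLS_one, leftEnd_lenLS_rho]
  clear h1
  have hk2 := k.2
  generalize (k : ℕ) = j at *
  set β := betaLS L S
  have hL' : (1 : ℝ) ≤ L := by exact_mod_cast hL
  have hβ2 : 0 < β ^ 2 := by positivity
  have hLβ : β ≤ L * β := le_mul_of_one_le_left hpos.le hL'
  unfold mapLS
  obtain ⟨hy1, hy2⟩ := hy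
  by_cases h0 : j = 0
  · subst h0
    simp only [Nat.cast_zero, zero_mul, Nat.zero_le, if_true, zero_add] at hy1 hy2 ⊢
    rw [if_pos (by omega)] at hy2
    rw [if_pos hy2]
    ring
  have hj1 : (1 : ℝ) ≤ j := by exact_mod_cast Nat.one_le_iff_ne_zero.2 h0
  by_cases h1 : j < L
  · have hjL : (j : ℝ) + 1 ≤ L := by exact_mod_cast h1
    rw [if_pos (by omega)] at hy1 hy2
    rw [if_pos (by omega)] at hy2
    rw [if_pos (by omega), if_neg h0, if_pos h1, if_neg (by nlinarith), if_pos (by nlinarith)]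
    ring
  have hle : (if j ≤ L then (j : ℝ) * β else L * β + (j - L) * β ^ 2) =
      L * β + (j - L) * β ^ 2 := by
    split_ifs with h2
    · rw [show j = L by omega]
      ring
    · rfl
  have hjL : (L : ℝ) ≤ j := by exact_mod_cast not_lt.1 h1
  rw [hle] at hy1 hy2
  rw [if_neg h1] at hy2
  rw [hle]
  have hβy : ¬ (y : ℝ) < β := by nlinarith
  have hLy : ¬ (y : ℝ) < L * β := by nlinarith
  rw [if_neg h0, if_neg h1, if_neg hβy, if_neg hLy]
  by_cases h2 : j + 1 = L + S
  · have hjS : (j : ℝ) = L + S - 1 := by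
      rw [eq_sub_iff_add_eq]
      exact_mod_cast h2
    rw [if_pos h2, if_neg, hjS]
    · linear_combination -heq
    · rw [hjS] at hy1
      nlinarith
  · have hjS : (j : ℝ) + 2 ≤ L + S := by
      have : j + 2 ≤ L + S := by omega
      exact_mod_cast this
    rw [if_neg h2, if_pos (by nlinarith)]
    ring

/-! ### The induced rotation and its towers -/

theorem abs_cutDev_le_one {c : ℝ} (hc : c ∈ Set.Icc (0 : ℝ) 1) (y : ℝ) : |cutDev c y| ≤ 1 := by
  obtain ⟨h0, h1⟩ := hc
  unfold cutDev
  split_ifs <;> rw [abs_le] <;> constructor <;> linarith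

theorem abs_birkhoffSum_le {α : Type*} (f : α → α) {φ : α → ℝ} (hφ : ∀ y, |φ y| ≤ 1) (N : ℕ)
    (y : α) : |birkhoffSum f φ N y| ≤ N := by
  refine (Finset.abs_sum_le_sum_abs _ _).trans ((Finset.sum_le_sum fun _ _ => hφ _).trans ?_)
  simp

/-- The rotation of `[0, β)` by `β ^ 2`, the first return map of `mapLS` to `[0, β)`. -/
noncomputable def rotLS (β z : ℝ) : ℝ := if z < β - β ^ 2 then z + β ^ 2 else z - β + β ^ 2

theorem rotLS_mem {β z : ℝ} (hβ : β < 1) (hz : z ∈ Set.Ico 0 β) : rotLS β z ∈ Set.Ico 0 β := by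
  obtain ⟨h0, h1⟩ := hz
  unfold rotLS
  split_ifs with h <;> constructor <;> nlinarith

/-- Scaling by `1 / β` turns the circle `[0, β)` into the unit circle and the step `β ^ 2` into `β`.
-/
theorem iterate_rotLS_div {β z : ℝ} (h0 : 0 < β) (h1 : β < 1) (hz : z ∈ Set.Ico 0 β) (k : ℕ) :
    (rotLS β)^[k] z / β = Int.fract (z / β + k * β) := by
  induction k with
  | zero =>
    have hz1 : z / β < 1 := (div_lt_one h0).2 hz.2
    simp [Int.fract_eq_self.2 ⟨div_nonneg hz.1 h0.le, hz1⟩]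
  | succ k ih =>
    rw [Function.iterate_succ_apply']
    rw [div_eq_iff h0.ne'] at ih ⊢
    rw [ih]
    set t := z / β + k * β with ht
    rw [show z / β + ((k + 1 : ℕ) : ℝ) * β = t + β by push_cast; ring]
    have hf0 := Int.fract_nonneg t
    have hf1 := Int.fract_lt_one t
    have hfl := Int.self_sub_floor t
    unfold rotLS
    split_ifs with h
    · have : Int.fract t < 1 - β := by nlinarith
      have h2 : Int.fract (t + β) = Int.fract t + β := by
        rw [Int.fract_eq_iff]
        exact ⟨by linarith, by linarith, ⌊t⌋, by linarith⟩
      rw [h2]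
      ring
    · have : 1 - β ≤ Int.fract t := by nlinarith
      have h2 : Int.fract (t + β) = Int.fract t + β - 1 := by
        rw [Int.fract_eq_iff]
        exact ⟨by linarith, by linarith, ⌊t⌋ + 1, by push_cast; linarith⟩
      rw [h2]
      ring

/-- The number of points of the `mapLS`-orbit strictly after a visit to `[0, β)` up to the next
visit `z`. -/
noncomputable def towerHeight (L S : ℕ) (β z : ℝ) : ℕ := L + if z < β ^ 2 then S else 0

/-- The sum of `φ` over the points counted by `towerHeight`. -/
noncomputable def towerSum (L S : ℕ) (β : ℝ) (φ : ℝ → ℝ) (z : ℝ) : ℝ :=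
  ∑ j ∈ Finset.range L, φ (z + j * β) +
    if z < β ^ 2 then ∑ k ∈ Finset.range S, φ (z + 1 - (k + 1) * β ^ 2) else 0

section Tower

variable {L S : ℕ} {β : ℝ}

theorem beta_lt_one (hL : 1 ≤ L) (hS : 1 ≤ S) (h0 : 0 < β) (heq : L * β + S * β ^ 2 = 1) :
    β < 1 := by
  have hL' : (1 : ℝ) ≤ L := by exact_mod_cast hL
  have hS' : (1 : ℝ) ≤ S := by exact_mod_cast hS
  have : 0 < β ^ 2 := by positivity
  nlinarith

/-- On `[β, L * β)` the map descends by `β`, so the orbit runs down the column above `z` to the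
base. -/
theorem mapLS_long_column (φ : ℝ → ℝ) {z : ℝ} (hz : z ∈ Set.Ico 0 β) {j : ℕ}
    (hj : j < L) : (mapLS L β)^[j] (z + j * β) = z ∧
      birkhoffSum (mapLS L β) φ (j + 1) (z + j * β) =
        ∑ i ∈ Finset.range (j + 1), φ (z + i * β) := by
  have h0 : 0 < β := hz.1.trans_lt hz.2
  induction j with
  | zero => simp
  | succ j ih =>
    have hjL : (j : ℝ) + 1 + 1 ≤ L := by exact_mod_cast hj
    have hj0 : (0 : ℝ) ≤ j := by positivity
    have hz0 := hz.1
    have hz1 := hz.2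
    have hstep : mapLS L β (z + (j + 1 : ℕ) * β) = z + j * β := by
      unfold mapLS
      push_cast
      rw [if_neg (by nlinarith), if_pos (by nlinarith)]
      ring
    obtain ⟨ih1, ih2⟩ := ih (by omega)
    constructor
    · rw [Function.iterate_succ_apply, hstep, ih1]
    · rw [birkhoffSum_succ', hstep, ih2, Finset.sum_range_succ _ (j + 1), add_comm]

/-- On `[L * β, 1 - β ^ 2)` the map climbs by `β ^ 2`, and the topmost short interval is sent onto
the start of the highest long interval. The index `m` counts levels from the top. -/
theorem mapLS_short_column (hL : 1 ≤ L) (heq : L * β + S * β ^ 2 = 1) (φ : ℝ → ℝ)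
    {z : ℝ} (h0 : 0 < β) (hz : z ∈ Set.Ico 0 (β ^ 2)) {m : ℕ} (hm : m < S) :
    (mapLS L β)^[m + 1] (z + 1 - (m + 1) * β ^ 2) = z + (L - 1) * β ∧
      birkhoffSum (mapLS L β) φ (m + 1) (z + 1 - (m + 1) * β ^ 2) =
        ∑ k ∈ Finset.range (m + 1), φ (z + 1 - (k + 1) * β ^ 2) := by
  obtain ⟨hz0, hz1⟩ := hz
  have hβ2 : 0 < β ^ 2 := by positivity
  have hL' : (1 : ℝ) ≤ L := by exact_mod_cast hL
  induction m with
  | zero =>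
    have hS' : (1 : ℝ) ≤ S := by exact_mod_cast hm
    constructor
    · simp only [zero_add, Function.iterate_one, Nat.cast_zero, one_mul]
      unfold mapLS
      rw [if_neg (by nlinarith), if_neg (by nlinarith), if_neg (by linarith)]
      ring
    · simp
  | succ m ih =>
    have hm' : (m : ℝ) + 1 + 1 ≤ S := by exact_mod_cast hm
    have hm0 : (0 : ℝ) ≤ m := by positivity
    have hstep : mapLS L β (z + 1 - ((m + 1 : ℕ) + 1) * β ^ 2) = z + 1 - (m + 1) * β ^ 2 := by
      unfold mapLS
      push_cast
      rw [if_neg (by nlinarith), if_neg (by nlinarith), if_pos (by nlinarith)]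
      ring
    obtain ⟨ih1, ih2⟩ := ih (by omega)
    constructor
    · rw [Function.iterate_succ_apply, hstep, ih1]
    · rw [birkhoffSum_succ', hstep, ih2, Finset.sum_range_succ _ (m + 1), add_comm]

/-- The point after a visit to the base already lies above the next return point `rotLS β z`: at the
bottom of the short column if there is one, otherwise at the top of the long one. Hence towers are
indexed by the return point. -/
theorem mapLS_base (heq : L * β + S * β ^ 2 = 1) {z : ℝ} (hz : z ∈ Set.Ico 0 β) :
    mapLS L β z = if rotLS β z < β ^ 2 then rotLS β z + 1 - S * β ^ 2
      else rotLS β z + (L - 1) * β := by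
  obtain ⟨hz0, hz1⟩ := hz
  unfold mapLS
  rw [if_pos hz1]
  unfold rotLS
  by_cases h : z < β - β ^ 2
  · rw [if_pos h, if_neg (by linarith)]
    ring
  · rw [if_neg h, if_pos (by linarith)]
    linear_combination heq

theorem mapLS_tower (hL : 1 ≤ L) (hS : 1 ≤ S) (heq : L * β + S * β ^ 2 = 1) (φ : ℝ → ℝ) {z : ℝ}
    (hz : z ∈ Set.Ico 0 β) :
    (mapLS L β)^[towerHeight L S β (rotLS β z)] (mapLS L β z) = mapLS L β (rotLS β z) ∧
      birkhoffSum (mapLS L β) φ (towerHeight L S β (rotLS β z)) (mapLS L β z) =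
        towerSum L S β φ (rotLS β z) := by
  have h0 : 0 < β := hz.1.trans_lt hz.2
  have hβ := beta_lt_one hL hS h0 heq
  have hz' := rotLS_mem hβ hz
  rw [mapLS_base heq hz]
  set w := rotLS β z
  obtain ⟨l, rfl⟩ : ∃ l, L = l + 1 := ⟨L - 1, by omega⟩
  obtain ⟨s, rfl⟩ : ∃ s, S = s + 1 := ⟨S - 1, by omega⟩
  have hl : ((l + 1 : ℕ) : ℝ) - 1 = l := by push_cast; ring
  obtain ⟨h1, h2⟩ := mapLS_long_column (L := l + 1) φ hz' (Nat.lt_succ_self l)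
  have h3 : (mapLS (l + 1 : ℕ) β)^[l + 1] (w + l * β) = mapLS (l + 1 : ℕ) β w := by
    rw [Function.iterate_succ_apply', h1]
  unfold towerHeight towerSum
  by_cases h : w < β ^ 2
  · simp only [if_pos h]
    obtain ⟨h4, h5⟩ := mapLS_short_column hL heq φ h0 ⟨hz'.1, h⟩ (Nat.lt_succ_self s)
    rw [hl] at h4
    rw [Nat.cast_succ s]
    constructor
    · rw [Function.iterate_add_apply, h4, h3]
    · rw [add_comm (l + 1), birkhoffSum_add, h5, h4, h2, add_comm]
  · simp only [if_neg h, add_zero, hl]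
    exact ⟨h3, h2⟩

theorem towerHeight_le (z : ℝ) : towerHeight L S β z ≤ L + S := by
  unfold towerHeight
  split_ifs <;> omega

/-- A Birkhoff sum of `mapLS` is, up to a bounded error, a Birkhoff sum of the rotation. -/
theorem exists_abs_birkhoffSum_sub_le (hL : 1 ≤ L) (hS : 1 ≤ S) (heq : L * β + S * β ^ 2 = 1)
    {φ : ℝ → ℝ} (hφ : ∀ y, |φ y| ≤ 1) (N : ℕ) {z : ℝ} (hz : z ∈ Set.Ico 0 β) :
    ∃ K ≤ N, |birkhoffSum (mapLS L β) φ N (mapLS L β z) -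
      ∑ k ∈ Finset.range K, towerSum L S β φ ((rotLS β)^[k + 1] z)| ≤ L + S := by
  induction N using Nat.strong_induction_on generalizing z with
  | _ N ih =>
    have h0 : 0 < β := hz.1.trans_lt hz.2
    have hβ := beta_lt_one hL hS h0 heq
    -- Only a final incomplete tower causes an error, and it has at most `L + S` points.
    rcases lt_or_ge N (towerHeight L S β (rotLS β z)) with h | h
    · refine ⟨0, Nat.zero_le _, ?_⟩
      rw [Finset.sum_range_zero, sub_zero]
      refine (abs_birkhoffSum_le _ hφ _ _).trans ?_
      exact_mod_cast h.le.trans (towerHeight_le _)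
    · obtain ⟨M, rfl⟩ := Nat.exists_eq_add_of_le h
      obtain ⟨h1, h2⟩ := mapLS_tower hL hS heq φ hz
      have hpos : 1 ≤ towerHeight L S β (rotLS β z) := le_add_right hL
      obtain ⟨K, hKM, hK⟩ := ih M (by omega) (rotLS_mem hβ hz)
      refine ⟨K + 1, by omega, ?_⟩
      rw [birkhoffSum_add, h1, h2, Finset.sum_range_succ']
      simp only [Function.iterate_succ_apply] at hK ⊢
      simp only [Function.iterate_zero, id]
      convert hK using 2
      ring

/-- Every point lies in a long or a short column, and following the columns to the base takes at
most `L + S` steps. -/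
theorem exists_iterate_mapLS_mem (hL : 1 ≤ L) (hS : 1 ≤ S) (h0 : 0 < β)
    (heq : L * β + S * β ^ 2 = 1) {y : ℝ} (hy : y ∈ Set.Ico (0 : ℝ) 1) :
    ∃ j ≤ L + S, (mapLS L β)^[j] y ∈ Set.Ico 0 β := by
  have hβ := beta_lt_one hL hS h0 heq
  have hβ2 : 0 < β ^ 2 := by positivity
  obtain ⟨hy0, hy1⟩ := hy
  rcases lt_or_ge y (L * β) with h | h
  · have hfl : (⌊y / β⌋₊ : ℝ) ≤ y / β := Nat.floor_le (by positivity)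
    have hfl2 := Nat.lt_floor_add_one (y / β)
    rw [le_div_iff₀ h0] at hfl
    rw [div_lt_iff₀ h0] at hfl2
    have hlt : ⌊y / β⌋₊ < L := by
      rw [Nat.floor_lt (by positivity), div_lt_iff₀ h0]
      exact h
    have hz : y - ⌊y / β⌋₊ * β ∈ Set.Ico 0 β := ⟨by linarith, by linarith⟩
    have h1 := (mapLS_long_column (fun _ => 0) hz hlt).1
    rw [sub_add_cancel] at h1
    exact ⟨⌊y / β⌋₊, by omega, by rw [h1]; exact hz⟩
  · have hn : 0 < (1 - y) / β ^ 2 := div_pos (by linarith) hβ2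
    have hc : (1 - y) / β ^ 2 ≤ ⌈(1 - y) / β ^ 2⌉₊ := Nat.le_ceil _
    have hc2 := Nat.ceil_lt_add_one hn.le
    have hcS : ⌈(1 - y) / β ^ 2⌉₊ ≤ S := by
      rw [Nat.ceil_le, div_le_iff₀ hβ2]
      linarith
    obtain ⟨m, hm⟩ : ∃ m, ⌈(1 - y) / β ^ 2⌉₊ = m + 1 :=
      ⟨⌈(1 - y) / β ^ 2⌉₊ - 1, by have := Nat.ceil_pos.2 hn; omega⟩
    rw [hm] at hc hc2 hcS
    push_cast at hc hc2
    rw [← sub_lt_iff_lt_add, lt_div_iff₀ hβ2] at hc2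
    rw [div_le_iff₀ hβ2] at hc
    have hz : y - 1 + (m + 1) * β ^ 2 ∈ Set.Ico 0 (β ^ 2) := ⟨by linarith, by linarith⟩
    have hz' : y - 1 + (m + 1) * β ^ 2 ∈ Set.Ico 0 β := ⟨hz.1, hz.2.trans (by nlinarith)⟩
    have h1 := (mapLS_short_column hL heq (fun _ => 0) h0 hz hcS).1
    have h2 := (mapLS_long_column (fun _ => 0) hz' (show L - 1 < L by omega)).1
    rw [Nat.cast_sub hL, Nat.cast_one, ← h1, ← Function.iterate_add_apply] at h2
    rw [show y - 1 + (m + 1) * β ^ 2 + 1 - (m + 1) * β ^ 2 = y by ring] at h2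
    exact ⟨L - 1 + (m + 1), by omega, by rw [h2]; exact hz'⟩

/-- Seen from the base, the part of a level below `c` is an initial segment of the level; the added
constant corrects the centring. -/
theorem cutDev_add_eq {b p c z : ℝ} (h0 : 0 < β) (hz : 0 ≤ z) (hzb : z < b) :
    cutDev c (z + p) =
      cutDev (clip b (c - p) / β) (z / β) + (clip b (c - p) / β - c) := by
  unfold cutDev
  have h : z / β < clip b (c - p) / β ↔ z + p < c := by
    rw [div_lt_div_iff_of_pos_right h0, lt_clip_iff hz hzb, lt_sub_iff_add_lt]
  simp only [h]
  ring

/-- Each level contributes one centred indicator. The short column is met only when `z < β ^ 2`, so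
its centring `S * c` is itself an indicator, which gives the `cutDev β` term. The constants cancel
because the mean return time `L + S * β` equals `1 / β`. -/
theorem towerSum_cutDev (h0 : 0 < β) (heq : L * β + S * β ^ 2 = 1) {c z : ℝ}
    (hc : c ∈ Set.Icc (0 : ℝ) 1) (hz : z ∈ Set.Ico 0 β) :
    towerSum L S β (cutDev c) z =
      ∑ j ∈ Finset.range L, cutDev (clip β (c - j * β) / β) (z / β) +
      ∑ k ∈ Finset.range S, cutDev (clip (β ^ 2) (c - (1 - (k + 1) * β ^ 2)) / β) (z / β) -
      S * c * cutDev β (z / β) := by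
  have hβ2 : 0 ≤ β ^ 2 := by positivity
  have hd := sum_range_clip (P := fun k => k * β) (b := fun _ => β) (n := L) (fun _ _ => h0.le)
    (fun k _ => by push_cast; ring) c
  have he : ∑ k ∈ Finset.range S, clip (β ^ 2) (c - (1 - (k + 1) * β ^ 2)) =
      min c 1 - min c (L * β) := by
    have h1 := Finset.sum_range_sub' (fun k : ℕ => min c (1 - k * β ^ 2)) S
    rw [show 1 - (S : ℝ) * β ^ 2 = L * β by linarith, Nat.cast_zero, zero_mul, sub_zero] at h1
    rw [← h1]
    refine Finset.sum_congr rfl fun k _ => ?_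
    rw [clip_sub hβ2]
    push_cast
    ring_nf
  rw [Nat.cast_zero, zero_mul, min_eq_right hc.1, sub_zero] at hd
  rw [min_eq_left hc.2] at he
  have hlong : ∑ j ∈ Finset.range L, cutDev c (z + j * β) =
      ∑ j ∈ Finset.range L, cutDev (clip β (c - j * β) / β) (z / β) +
        (min c (L * β) / β - L * c) := by
    rw [← hd, Finset.sum_div, Finset.sum_congr rfl fun j _ => cutDev_add_eq h0 hz.1 hz.2,
      Finset.sum_add_distrib, Finset.sum_sub_distrib]
    simp
  have hzβ : z / β < β ↔ z < β ^ 2 := by rw [div_lt_iff₀ h0, sq]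
  have hshort : (if z < β ^ 2 then ∑ k ∈ Finset.range S, cutDev c (z + 1 - (k + 1) * β ^ 2)
      else 0) = ∑ k ∈ Finset.range S,
        cutDev (clip (β ^ 2) (c - (1 - (k + 1) * β ^ 2)) / β) (z / β) +
        ((c - min c (L * β)) / β - S * c * if z < β ^ 2 then 1 else 0) := by
    rw [← he, Finset.sum_div]
    split_ifs with h
    · simp only [add_sub_assoc]
      rw [Finset.sum_congr rfl fun k _ => cutDev_add_eq h0 hz.1 h,
        Finset.sum_add_distrib, Finset.sum_sub_distrib]
      simp
    · rw [mul_zero, sub_zero, ← Finset.sum_add_distrib]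
      -- Here `z ≥ β ^ 2` is beyond every truncated threshold, so all indicators vanish.
      refine (Finset.sum_eq_zero fun k _ => ?_).symm
      unfold cutDev
      rw [if_neg]
      · ring
      · rw [not_lt, div_le_div_iff_of_pos_right h0]
        exact (clip_mem hβ2 _).2.trans (not_lt.1 h)
  rw [towerSum, hlong, hshort]
  have hcut : cutDev β (z / β) = (if z < β ^ 2 then 1 else 0) - β := by
    unfold cutDev
    simp only [hzβ]
  rw [hcut]
  have : c / β = L * c + S * c * β := by
    rw [div_eq_iff h0.ne']
    linear_combination (-c) * heq
  rw [sub_div, this]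
  ring

/-- Orbits of `mapLS` have logarithmic discrepancy. -/
theorem exists_abs_birkhoffSum_mapLS_le (hL : 1 ≤ L) (hS : 1 ≤ S) (h0 : 0 < β)
    (heq : L * β + S * β ^ 2 = 1) {κ : ℝ} (hκ : 0 < κ)
    (hbad : ∀ r : ℚ, κ ≤ |β - r| * (r.den : ℝ) ^ 2) :
    ∃ C : ℝ, 0 ≤ C ∧ ∀ c ∈ Set.Icc (0 : ℝ) 1, ∀ (N : ℕ), ∀ y ∈ Set.Ico (0 : ℝ) 1,
      |birkhoffSum (mapLS L β) (cutDev c) N y| ≤ C * (Real.log (N + 1) + 1) := by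
  have hβ := beta_lt_one hL hS h0 heq
  have hβ2 : β ^ 2 ≤ β := by nlinarith
  obtain ⟨C, hC, hrot⟩ := exists_abs_sum_cutDev_fract_le_log hκ hbad
  have htower : ∀ c ∈ Set.Icc (0 : ℝ) 1, ∀ (K : ℕ), ∀ z ∈ Set.Ico 0 β,
      |∑ k ∈ Finset.range K, towerSum L S β (cutDev c) ((rotLS β)^[k + 1] z)| ≤
        (L + S + S) * (C * Real.log (K + 1)) := by
    intro c hc K z hz
    have hmem : ∀ k, (rotLS β)^[k] z ∈ Set.Ico 0 β := by
      intro k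
      induction k with
      | zero => exact hz
      | succ k ih => rw [Function.iterate_succ_apply']; exact rotLS_mem hβ ih
    have hone : ∀ a ∈ Set.Icc (0 : ℝ) 1,
        |∑ k ∈ Finset.range K, cutDev a ((rotLS β)^[k + 1] z / β)| ≤ C * Real.log (K + 1) := by
      intro a ha
      -- The start is `z / β + β` because the tower sums begin at the first return, not at `z`.
      convert hrot a ha K (z / β + β) using 5 with k
      rw [iterate_rotLS_div h0 hβ hz]
      push_cast
      ring_nf
    have hclip : ∀ b ∈ Set.Icc 0 β, ∀ x, clip b x / β ∈ Set.Icc (0 : ℝ) 1 := by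
      intro b hb x
      have h1 := clip_mem hb.1 x
      exact ⟨div_nonneg h1.1 h0.le, (div_le_one h0).2 (h1.2.trans hb.2)⟩
    rw [Finset.sum_congr rfl fun k _ => towerSum_cutDev h0 heq hc (hmem (k + 1)),
      Finset.sum_sub_distrib, Finset.sum_add_distrib, Finset.sum_comm,
      Finset.sum_comm (s := Finset.range K) (t := Finset.range S), ← Finset.mul_sum]
    have hlog : 0 ≤ C * Real.log (K + 1) := mul_nonneg hC (Real.log_nonneg (by simp))
    have hsum : ∀ (n : ℕ) (a : ℕ → ℝ), (∀ j, a j ∈ Set.Icc (0 : ℝ) 1) →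
        |∑ j ∈ Finset.range n, ∑ k ∈ Finset.range K, cutDev (a j) ((rotLS β)^[k + 1] z / β)| ≤
          n * (C * Real.log (K + 1)) := by
      intro n a ha
      refine (Finset.abs_sum_le_sum_abs _ _).trans
        ((Finset.sum_le_sum fun j _ => hone _ (ha j)).trans ?_)
      simp
    have h1 := hsum L (fun j => clip β (c - j * β) / β) fun j => hclip _ ⟨h0.le, le_rfl⟩ _
    have h2 := hsum S (fun k => clip (β ^ 2) (c - (1 - (k + 1) * β ^ 2)) / β)
      fun j => hclip _ ⟨by positivity, hβ2⟩ _
    have h3 : |S * c * ∑ k ∈ Finset.range K, cutDev β ((rotLS β)^[k + 1] z / β)| ≤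
        S * (C * Real.log (K + 1)) := by
      rw [abs_mul, abs_of_nonneg (mul_nonneg (Nat.cast_nonneg S) hc.1)]
      have hSc : S * c ≤ S := mul_le_of_le_one_right (Nat.cast_nonneg S) hc.2
      exact mul_le_mul hSc (hone β ⟨h0.le, hβ.le⟩) (abs_nonneg _) (Nat.cast_nonneg S)
    refine (abs_sub _ _).trans ((add_le_add ((abs_add_le _ _).trans (add_le_add h1 h2)) h3).trans ?_)
    linarith
  -- The factor `L + S + S` comes from the rotation deviations in a tower sum; `L + S + 1` bounds
  -- the steps up to and just past the first visit to the base, and another `L + S` the incomplete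
  -- last tower.
  refine ⟨(L + S + S) * C + (2 * (L + S) + 1), by positivity, fun c hc N y hy => ?_⟩
  have hφ := abs_cutDev_le_one hc
  have hlogN : 0 ≤ Real.log (N + 1) := Real.log_nonneg (by simp)
  obtain ⟨j, hj, hz⟩ := exists_iterate_mapLS_mem hL hS h0 heq hy
  have hj' : (j : ℝ) ≤ L + S := by exact_mod_cast hj
  have hLS : (0 : ℝ) ≤ L + S := by positivity
  have hA : 0 ≤ (L + S + S) * C := by positivity
  rcases le_or_gt N (j + 1) with h | h
  · have h1 : (N : ℝ) ≤ j + 1 := by exact_mod_cast h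
    refine (abs_birkhoffSum_le _ hφ _ _).trans ?_
    nlinarith
  · obtain ⟨M, rfl⟩ := Nat.exists_eq_add_of_lt h
    rw [show j + 1 + M + 1 = (j + 1) + (M + 1) by ring] at hlogN ⊢
    rw [birkhoffSum_add, Function.iterate_succ_apply']
    obtain ⟨K, hK, hKs⟩ := exists_abs_birkhoffSum_sub_le hL hS heq hφ (M + 1) hz
    have h1 := abs_birkhoffSum_le (mapLS L β) hφ (j + 1) y
    have h2 := htower c hc K _ hz
    have h3 : Real.log (K + 1) ≤ Real.log (((j + 1 + (M + 1) : ℕ) : ℝ) + 1) := by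
      apply Real.log_le_log (by positivity)
      have : K ≤ j + 1 + (M + 1) := by omega
      have : (K : ℝ) ≤ (j + 1 + (M + 1) : ℕ) := by exact_mod_cast this
      linarith
    have h4 : (L + S + S) * (C * Real.log (K + 1)) ≤
        (L + S + S) * C * Real.log (((j + 1 + (M + 1) : ℕ) : ℝ) + 1) := by
      rw [← mul_assoc]
      exact mul_le_mul_of_nonneg_left h3 hA
    have h5 : |birkhoffSum (mapLS L β) (cutDev c) (M + 1) (mapLS L β ((mapLS L β)^[j] y))| ≤
        L + S + (L + S + S) * (C * Real.log (K + 1)) :=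
      (sub_le_iff_le_add.1 (abs_sub_abs_le_abs_sub _ _)).trans (add_le_add hKs h2)
    push_cast at h1
    refine (abs_add_le _ _).trans ?_
    nlinarith

end Tower

/-! ### From deviation sums to star-discrepancy, and conjugation -/

theorem countBelow_sub (P : ℕ → Set.Ico (0 : ℝ) 1) (N : ℕ) (a : ℝ) :
    (countBelow P N a : ℝ) - N * a = ∑ i ∈ Finset.range N, cutDev a (P (i + 1)) := by
  have h : Finset.Icc 1 N = (Finset.range N).map (addRightEmbedding 1) := by
    ext i
    simp only [Finset.mem_Icc, Finset.mem_map, Finset.mem_range, addRightEmbedding_apply]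
    exact ⟨fun hi => ⟨i - 1, by omega, by omega⟩, by rintro ⟨j, hj, rfl⟩; omega⟩
  rw [countBelow, Finset.card_filter, h, Finset.sum_map]
  simp [cutDev]

/-- Only large `N` matter: for `N ≥ 3` one has `1 ≤ log N` and `log (N + 1) ≤ 2 * log N`, which
absorbs the additive constant. Uniformity in `a` handles the supremum. -/
theorem isLowDiscrepancy_of_le {P : ℕ → Set.Ico (0 : ℝ) 1} {C : ℝ} (hC : 0 ≤ C)
    (h : ∀ a ∈ Set.Icc (0 : ℝ) 1, ∀ N : ℕ,
      |∑ i ∈ Finset.range N, cutDev a (P (i + 1))| ≤ C * (Real.log (N + 1) + 1)) :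
    IsLowDiscrepancy P := by
  refine IsBigO.of_bound (4 * C) ?_
  filter_upwards [eventually_ge_atTop 3] with N hN
  have hN' : (3 : ℝ) ≤ N := by exact_mod_cast hN
  have hlog1 : 1 ≤ Real.log N := by
    rw [Real.le_log_iff_exp_le (by linarith)]
    linarith [Real.exp_one_lt_d9]
  have hlog2 : Real.log (N + 1) ≤ 2 * Real.log N := by
    rw [show 2 * Real.log N = Real.log ((N : ℝ) ^ 2) by rw [Real.log_pow]; norm_num]
    exact Real.log_le_log (by linarith) (by nlinarith)
  have hN0 : (0 : ℝ) < N := by linarith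
  rw [starDiscrepancy, Real.norm_of_nonneg (Real.iSup_nonneg fun _ => abs_nonneg _),
    Real.norm_of_nonneg (by positivity)]
  refine Real.iSup_le (fun a => ?_) (by positivity)
  rw [measureReal_def, Real.volume_Ico, sub_zero, ENNReal.toReal_ofReal a.2.1]
  have h1 := h a a.2 N
  rw [← countBelow_sub] at h1
  have h2 : (countBelow P N a : ℝ) / N - a = (N : ℝ)⁻¹ * (countBelow P N a - N * a) := by
    field_simp
  rw [h2, abs_mul, abs_of_nonneg (by positivity : 0 ≤ (N : ℝ)⁻¹),
    mul_left_comm (4 * C)]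
  refine mul_le_mul_of_nonneg_left (h1.trans ?_) (by positivity)
  nlinarith

theorem iterate_conj {X : Type*} (g f : Equiv.Perm X) (x : X) (i : ℕ) :
    (⇑g ∘ ⇑f ∘ ⇑g.symm)^[i] x = g (f^[i] (g.symm x)) := by
  induction i with
  | zero => simp
  | succ i ih => simp [Function.iterate_succ_apply', ih]

theorem mainTheorem6 (L S : ℕ) (hL : 1 ≤ L) (hS : 1 ≤ S) (hLS : S ≤ L)
    (g : Equiv.Perm (Set.Ico (0 : ℝ) 1)) (hg : IsIET g) (x : Set.Ico (0 : ℝ) 1) :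
    IsLowDiscrepancy (orbitSeq (⇑g ∘ ⇑(fLS L S hL hS) ∘ ⇑g.symm) x) := by
  obtain ⟨n, D, rfl⟩ := hg
  obtain ⟨κ, hκ, hbad⟩ := exists_le_abs_betaLS_sub hS hLS
  obtain ⟨C, hC, hbound⟩ := exists_abs_birkhoffSum_mapLS_le hL hS (betaLS_pos L S hS)
    (betaLS_eq L S hS) hκ hbad
  -- Each of the `n` pieces of the conjugating exchange contributes two deviations.
  refine isLowDiscrepancy_of_le (C := n * (2 * C)) (by positivity) fun a ha N => ?_
  set f := fLS L S hL hS
  -- One application of `f` is built into `y` because the orbit is counted from `i = 1`.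
  set y := f (D.toPerm.symm x) with hy
  have hcoe : ∀ i, ((f^[i] y : Set.Ico (0 : ℝ) 1) : ℝ) = (mapLS L (betaLS L S))^[i] y :=
    fun i => (Function.Semiconj.iterate_right (f := Subtype.val) (coe_fLS L S hL hS) i) y
  have hsum : ∑ i ∈ Finset.range N, cutDev a (orbitSeq (⇑D.toPerm ∘ ⇑f ∘ ⇑D.toPerm.symm) x (i + 1))
      = ∑ α, (birkhoffSum (mapLS L (betaLS L S)) (cutDev (IETData.leftEnd D.len D.π₀ α +
          clip (D.len α) (a - IETData.leftEnd D.len D.π₁ α))) N y -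
        birkhoffSum (mapLS L (betaLS L S)) (cutDev (IETData.leftEnd D.len D.π₀ α)) N y) := by
    simp only [birkhoffSum, ← Finset.sum_sub_distrib]
    rw [Finset.sum_comm]
    refine Finset.sum_congr rfl fun i _ => ?_
    rw [orbitSeq, iterate_conj, Function.iterate_succ_apply, D.cutDev_toPerm ha, hcoe]
  rw [hsum]
  refine (Finset.abs_sum_le_sum_abs _ _).trans ((Finset.sum_le_sum (g := fun _ =>
    2 * (C * (Real.log (N + 1) + 1))) fun α _ => ?_).trans ?_)
  · have h0 := D.leftEnd_nonneg D.π₀ α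
    have h1 := D.leftEnd_add_le_one D.π₀ α
    have h2 := clip_mem (D.len_pos α).le (a - IETData.leftEnd D.len D.π₁ α)
    have h3 := D.len_pos α
    refine (abs_sub _ _).trans ?_
    rw [two_mul]
    exact add_le_add (hbound _ ⟨by linarith [h2.1], by linarith [h2.2]⟩ N y y.2)
      (hbound _ ⟨h0, by linarith⟩ N y y.2)
  · simp [mul_assoc]
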